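/- A distance monoid is a set $R$ with a total order $\le$, an element $0\in R$ and an associative, commutative operation $\oplus$ such that, for all $r,s,t,u\in R$: $r\le r\oplus s$; if $r\le t$ and $s\le u$, then $r\oplus s\le t\oplus u$; and $r\oplus 0=r=0\oplus r$. Its Archimedean complexity $\mathrm{arch}(R)$ is the least $m\in\mathbb{N}$ such that $r_0\oplus r_1\oplus\cdots\oplus r_m=r_1\oplus\cdots\oplus r_m$ for all $r_0\le r_1\le\cdots\le r_m$ in $R$ (the empty sum being $0$), and $\mathrm{arch}(R)=\omega$ if there is no such $m$. Let $DM(n,m)$ denote the number of distance monoids, up to isomorphism, that have exactly $n$ non-zero elements and Archimedean complexity $m$. Theorem. For every fixed $k\in\mathbb{N}$ (including $k=0$), $DM(n,n-k)=O(n^k)$ as $n\to\infty$; that is, there are constants $C>0$ and $n_0$, depending only on $k$, such that $DM(n,n-k)\le C\,n^k$ for all $n\ge n_0$. -/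

import Mathlib

open Filter Asymptotics

/-- A distance magma structure on `R`: a total order `le`, an element `zero` and a commutative,
positive, order-compatible addition `add` with unit `zero`. -/
@[ext]
structure DistanceMagma (R : Type*) where
  add : R → R → R
  le : R → R → Prop
  zero : R
  le_refl : ∀ r, le r r
  le_antisymm : ∀ r s, le r s → le s r → r = s
  le_trans : ∀ r s t, le r s → le s t → le r t
  le_total : ∀ r s, le r s ∨ le s r
  le_add : ∀ r s, le r (add r s)
  add_le_add : ∀ r s t u, le r t → le s u → le (add r s) (add t u)
  add_comm : ∀ r s, add r s = add s r
  add_zero : ∀ r, add r zero = r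
  zero_add : ∀ r, add zero r = r

/-- A distance monoid structure on `R`: a distance magma structure whose addition is
associative. -/
@[ext]
structure DistanceMonoid (R : Type*) extends DistanceMagma R where
  add_assoc : ∀ r s t, add (add r s) t = add r (add s t)

namespace DistanceMonoid

variable {R S T : Type*}

/-- The sum `r₀ ⊕ r₁ ⊕ ⋯` of a finite sequence; the empty sum is `0`. -/
def sum (M : DistanceMonoid R) {m : ℕ} (r : Fin m → R) : R :=
  (List.ofFn r).foldr M.add M.zero

/-- `r₀ ⊕ r₁ ⊕ ⋯ ⊕ rₘ = r₁ ⊕ ⋯ ⊕ rₘ` for all `r₀ ≤ r₁ ≤ ⋯ ≤ rₘ`. -/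
def AbsorbsFirst (M : DistanceMonoid R) (m : ℕ) : Prop :=
  ∀ r : Fin (m + 1) → R, (∀ i j, i ≤ j → M.le (r i) (r j)) →
    M.sum r = M.sum (fun i : Fin m => r i.succ)

/-- The Archimedean complexity: the least `m` such that `M.AbsorbsFirst m`; it is `⊤` (in the role
of `ω`) if there is no such `m`. -/
noncomputable def arch (M : DistanceMonoid R) : ℕ∞ :=
  sInf {a : ℕ∞ | ∃ m : ℕ, a = m ∧ M.AbsorbsFirst m}

/-- Isomorphism of distance monoids: a bijection that preserves addition, order and zero. -/
def IsIso (M : DistanceMonoid R) (N : DistanceMonoid S) : Prop :=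
  ∃ e : R ≃ S, (∀ r s, e (M.add r s) = N.add (e r) (e s)) ∧
    (∀ r s, M.le r s ↔ N.le (e r) (e s)) ∧ e M.zero = N.zero

theorem IsIso.refl (M : DistanceMonoid R) : M.IsIso M :=
  ⟨Equiv.refl R, fun _ _ => rfl, fun _ _ => Iff.rfl, rfl⟩

theorem IsIso.symm {M : DistanceMonoid R} {N : DistanceMonoid S} (h : M.IsIso N) :
    N.IsIso M := by
  obtain ⟨e, h1, h2, h3⟩ := h
  refine ⟨e.symm, fun r s => ?_, fun r s => ?_, ?_⟩
  · rw [Equiv.symm_apply_eq, h1, e.apply_symm_apply, e.apply_symm_apply]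
  · rw [h2, e.apply_symm_apply, e.apply_symm_apply]
  · rw [Equiv.symm_apply_eq, h3]

theorem IsIso.trans {M : DistanceMonoid R} {N : DistanceMonoid S} {P : DistanceMonoid T}
    (h : M.IsIso N) (h' : N.IsIso P) : M.IsIso P := by
  obtain ⟨e, h1, h2, h3⟩ := h
  obtain ⟨f, g1, g2, g3⟩ := h'
  refine ⟨e.trans f, fun r s => ?_, fun r s => ?_, ?_⟩
  · simp only [Equiv.trans_apply, h1, g1]
  · simp only [Equiv.trans_apply, h2 r s, g2 (e r) (e s)]
  · simp only [Equiv.trans_apply, h3, g3]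

/-- Isomorphism as an equivalence relation on the distance monoid structures on
`Fin (n + 1)` (a set with `n + 1` elements, that is, zero and `n` non-zero elements) that have
Archimedean complexity `k`. -/
def isoSetoid (n k : ℕ) : Setoid {M : DistanceMonoid (Fin (n + 1)) // M.arch = k} where
  r M N := M.1.IsIso N.1
  iseqv := ⟨fun M => IsIso.refl M.1, fun h => h.symm, fun h h' => h.trans h'⟩

/-- There are only finitely many distance monoid structures on a finite set. -/
instance [Finite R] : Finite (DistanceMonoid R) :=
  Finite.of_injective
    (fun M : DistanceMonoid R => ((M.add, M.le, M.zero) : (R → R → R) × (R → R → Prop) × R))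
    (fun M N h => by
      simp only [Prod.mk.injEq] at h
      exact DistanceMonoid.ext h.1 h.2.1 h.2.2)

end DistanceMonoid

/-- `DM n k`: the number of distance monoids, up to isomorphism, with `n` non-zero elements and
Archimedean complexity `k`. -/
noncomputable def DM (n k : ℕ) : ℕ :=
  Nat.card (Quotient (DistanceMonoid.isoSetoid n k))

/-! Let `m = n - k`. Complexity `m` yields an irredundant family `A` of `m` elements: deleting any
member lowers the sum. Adding the members one at a time gives `m + 1` distinct partial sums, so only
`k` elements lie off such a chain, and at most `k + |B|` lie below the sum of a subfamily `B`. For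
`m > (k + 1)²` this forces some `a` to occur at least `k + 2` times in `A`, and comparing the other
members with `a` shows that `0, a, …, m · a` are distinct (`exists_nsmul_lt_nsmul`). So all but `k`
elements are multiples of `a`. The order positions of these `k` elements can be chosen in at most
`(n + 1)^k` ways. An element between `p · a` and `(p + 1) · a` added to one between `q · a` and `(q
+ 1) · a` gives a sum between `(p + q) · a` and `(p + q + 2) · a`, so each sum is an exceptional
element or one of three multiples (`IsChain.exists_decode`). A number of such choices depending only
on `k` then fixes the addition (`IsCode.eq`). -/

/-! ### Irredundant sums in finite ordered monoids -/

section OrderedMonoid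

variable {R : Type*} [AddCommMonoid R] [LinearOrder R] [IsOrderedAddMonoid R] [Fintype R]

omit [Fintype R] in
/-- If removing any element of `A` decreases its sum, the same holds for each subfamily `B`. -/
theorem sum_erase_lt_of_le {A B : Multiset R}
    (hA : ∀ x ∈ A, (A.erase x).sum < A.sum) (hBA : B ≤ A) {x : R}
    (hx : x ∈ B) : (B.erase x).sum < B.sum := by
  obtain ⟨C, rfl⟩ := Multiset.le_iff_exists_add.1 hBA
  have h := hA x (Multiset.mem_add.2 (Or.inl hx))
  rw [Multiset.erase_add_left_pos _ hx, Multiset.sum_add, Multiset.sum_add] at h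
  exact lt_of_add_lt_add_right h

omit [Fintype R] in
theorem sum_lt_sum_cons {A B : Multiset R} {x : R}
    (hA : ∀ x ∈ A, (A.erase x).sum < A.sum) (hBA : x ::ₘ B ≤ A) : B.sum < x + B.sum := by
  simpa using sum_erase_lt_of_le hA hBA (Multiset.mem_cons_self x B)

/-- Moving the elements of `C` into `B` one by one raises the sum strictly each time, so the set of
elements above it loses a member at each step. This is why `B` varies in the induction on `C`. -/
theorem card_le_card_filter_ge {A : Multiset R}
    (hA : ∀ x ∈ A, (A.erase x).sum < A.sum) (C : Multiset R) :
    ∀ B : Multiset R, B + C ≤ A →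
      C.card + 1 ≤ (Finset.univ.filter fun z : R => B.sum ≤ z).card := by
  induction C using Multiset.induction with
  | empty =>
    intro B _
    simp only [Multiset.card_zero, zero_add]
    exact Finset.card_pos.2 ⟨B.sum, by simp⟩
  | cons x C ih =>
    intro B hB
    have hB' : (x ::ₘ B) + C ≤ A := by
      rwa [Multiset.cons_add, ← Multiset.add_cons]
    have h1 := ih (x ::ₘ B) hB'
    have h2 := sum_lt_sum_cons hA ((Multiset.le_add_right _ _).trans hB')
    rw [Multiset.card_cons]
    refine lt_of_le_of_lt h1 (Finset.card_lt_card ?_)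
    rw [Multiset.sum_cons, Finset.ssubset_iff_of_subset]
    · exact ⟨B.sum, by simp, by simpa using h2⟩
    · intro z
      simp only [Finset.mem_filter, Finset.mem_univ, true_and]
      exact fun h => h2.le.trans h

/-- At least `|A| - |B| + 1` elements lie above the sum of a subfamily `B` of `A`, so only few lie
below it. -/
theorem card_filter_lt_sum_le {A B : Multiset R} {k : ℕ}
    (hA : ∀ x ∈ A, (A.erase x).sum < A.sum) (hcard : Fintype.card R = A.card + k + 1)
    (hBA : B ≤ A) : (Finset.univ.filter fun z : R => z < B.sum).card ≤ k + B.card := by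
  obtain ⟨C, rfl⟩ := Multiset.le_iff_exists_add.1 hBA
  have h1 := card_le_card_filter_ge hA C B le_rfl
  have h2 := Finset.card_filter_add_card_filter_not (s := (Finset.univ : Finset R))
    (fun z : R => z < B.sum)
  simp only [not_lt, Finset.card_univ, hcard, Multiset.card_add] at h2
  omega

omit [AddCommMonoid R] [IsOrderedAddMonoid R] in
theorem card_filter_lt_lt_card_filter_lt {u v : R} (h : u < v) :
    (Finset.univ.filter fun z : R => z < u).card < (Finset.univ.filter fun z : R => z < v).card := by
  refine Finset.card_lt_card ?_
  rw [Finset.ssubset_iff_of_subset]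
  · exact ⟨u, by simpa using h, by simp⟩
  · intro z
    simp only [Finset.mem_filter, Finset.mem_univ, true_and]
    exact fun hz => hz.trans h

omit [IsOrderedAddMonoid R] in
theorem le_card_filter_lt_nsmul {a : R} {l : ℕ} (h : ∀ y < l, y • a < (y + 1) • a) :
    l ≤ (Finset.univ.filter fun z : R => z < l • a).card := by
  induction l with
  | zero => exact Nat.zero_le _
  | succ l ih =>
    exact lt_of_le_of_lt (ih fun y hy => h y (hy.trans (Nat.lt_succ_self l)))
      (card_filter_lt_lt_card_filter_lt (h l (Nat.lt_succ_self l)))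

-- The elements `0 < x < a < a + x < 2a < ⋯` interleave, two for each multiple of `a`.
omit [IsOrderedAddMonoid R] in
theorem two_mul_le_card_filter_lt_nsmul {a x : R} {l : ℕ}
    (h : ∀ y < l, y • a < y • a + x) (h' : ∀ y < l, y • a + x < (y + 1) • a) :
    2 * l ≤ (Finset.univ.filter fun z : R => z < l • a).card := by
  induction l with
  | zero => simp
  | succ l ih =>
    have h0 := ih (fun y hy => h y (hy.trans (Nat.lt_succ_self l)))
      (fun y hy => h' y (hy.trans (Nat.lt_succ_self l)))
    have h1 := h l (Nat.lt_succ_self l)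
    have h2 := h' l (Nat.lt_succ_self l)
    have h3 := card_filter_lt_lt_card_filter_lt h1
    have h4 := card_filter_lt_lt_card_filter_lt h2
    omega

/-- Pigeonhole: at most `k + 1` elements lie below the maximum `t` of `A`, one of them being `0`,
which is not in `A`. Hence `A` has at most `k + 1` distinct values. -/
theorem exists_lt_count {A : Multiset R} {k : ℕ} (hpos : ∀ x : R, 0 ≤ x)
    (hA : ∀ x ∈ A, (A.erase x).sum < A.sum) (hcard : Fintype.card R = A.card + k + 1)
    (hbig : (k + 1) * (k + 1) < A.card) : ∃ a ∈ A, k + 1 < A.count a := by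
  have hne : A.toFinset.Nonempty := by
    rw [Multiset.toFinset_nonempty]
    rintro rfl
    simp at hbig
  obtain ⟨t, htA, ht⟩ := A.toFinset.exists_max_image id hne
  simp only [id, Multiset.mem_toFinset] at htA ht
  have h0A : (0 : R) ∉ A := fun h => by
    have := sum_lt_sum_cons (B := 0) hA (x := 0) (by simpa using h)
    simp at this
  have hlt : (Finset.univ.filter fun z : R => z < t).card ≤ k + 1 := by
    simpa using card_filter_lt_sum_le (B := {t}) hA hcard (by simpa using htA)
  have hAcard : A.toFinset.card ≤ k + 1 := by
    have hsub : A.toFinset.erase t ⊆ (Finset.univ.filter fun z : R => z < t).erase 0 := by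
      intro z hz
      simp only [Finset.mem_erase, Multiset.mem_toFinset] at hz
      simp only [Finset.mem_erase, Finset.mem_filter, Finset.mem_univ, true_and]
      exact ⟨fun h => h0A (h ▸ hz.2), lt_of_le_of_ne (ht z hz.2) hz.1⟩
    have h1 := Finset.card_le_card hsub
    have h0t : (0 : R) < t := lt_of_le_of_ne (hpos t) fun h => h0A (h ▸ htA)
    rw [Finset.card_erase_of_mem (by simpa using htA), Finset.card_erase_of_mem (by simpa using h0t)]
      at h1
    have : 0 < (Finset.univ.filter fun z : R => z < t).card :=
      Finset.card_pos.2 ⟨0, by simpa using h0t⟩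
    omega
  by_contra! hcon
  have h2 : A.card ≤ A.toFinset.card * (k + 1) := by
    rw [← Multiset.toFinset_sum_count_eq, ← smul_eq_mul]
    exact Finset.sum_le_card_nsmul _ _ _ fun x hx => hcon x (Multiset.mem_toFinset.1 hx)
  have h3 := Nat.mul_le_mul_right (k + 1) hAcard
  omega

-- In the presence of `k • a`, each member of `B` counts for at least one `a`. The members are
-- exchanged for copies of `a` one at a time.
omit [Fintype R] in
theorem nsmul_add_card_nsmul_le {a : R} {k : ℕ} (B : Multiset R)
    (h : ∀ x ∈ B, k • a + a ≤ k • a + x) : k • a + B.card • a ≤ k • a + B.sum := by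
  induction B using Multiset.induction with
  | empty => simp
  | cons x B ih =>
    rw [Multiset.card_cons, Multiset.sum_cons]
    calc k • a + (B.card + 1) • a = (k • a + B.card • a) + a := by rw [succ_nsmul]; abel
      _ ≤ (k • a + B.sum) + a := by
        exact add_le_add_left (ih fun y hy => h y (Multiset.mem_cons_of_mem hy)) a
      _ = (k • a + a) + B.sum := by abel
      _ ≤ (k • a + x) + B.sum := by
        exact add_le_add_left (h x (Multiset.mem_cons_self x B)) _
      _ = k • a + (x + B.sum) := by abel

/-- A finite positively ordered commutative monoid with a long irredundant sum has an element
all of whose first multiples are distinct. -/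
theorem exists_nsmul_lt_nsmul {A : Multiset R} {k : ℕ} (hpos : ∀ x : R, 0 ≤ x)
    (hA : ∀ x ∈ A, (A.erase x).sum < A.sum) (hcard : Fintype.card R = A.card + k + 1)
    (hbig : (k + 1) * (k + 1) < A.card) : ∃ a : R, (A.card - 1) • a ≠ A.card • a := by
  obtain ⟨a, haA, hcount⟩ := exists_lt_count hpos hA hcard hbig
  have hmono : ∀ {p q : ℕ}, p ≤ q → p • a ≤ q • a := fun h => nsmul_le_nsmul_left (hpos a) h
  have hrep : ∀ {y : ℕ}, y ≤ k + 2 → Multiset.replicate y a ≤ A := fun h =>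
    Multiset.le_count_iff_replicate_le.1 (by omega)
  have hstep : ∀ y < k + 2, y • a < (y + 1) • a := by
    intro y hy
    have := sum_lt_sum_cons (x := a) (B := Multiset.replicate y a) hA
      (by rw [← Multiset.replicate_succ]; exact hrep (by omega))
    rwa [Multiset.sum_replicate, ← succ_nsmul'] at this
  -- Otherwise the `k + 2` elements `0, a, …, (k + 1) • a` all lie below `x`, where only `k + 1` are
  -- allowed.
  have hupper : ∀ x ∈ A, x ≤ (k + 1) • a := by
    intro x hx
    by_contra! hlt
    have h1 := card_filter_lt_sum_le (B := {x}) hA hcard (by simpa using hx)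
    have h2 := le_card_filter_lt_nsmul (l := k + 1) fun y hy => hstep y (by omega)
    have h3 : (Finset.univ.filter fun z : R => z < (k + 1) • a).card <
        (Finset.univ.filter fun z : R => z < x).card := card_filter_lt_lt_card_filter_lt hlt
    simp only [Multiset.sum_singleton, Multiset.card_singleton] at h1
    omega
  -- Otherwise `x < a` and the interleaving puts `2 * (k + 1)` elements below `(k + 1) • a`, where
  -- only `k + (k + 1)` are allowed.
  have hlower : ∀ x ∈ A, k • a + a ≤ k • a + x := by
    intro x hx
    rcases le_or_gt a x with hax | hxa
    · gcongr
    by_contra! hlt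
    have h1 : ∀ y < k + 1, y • a < y • a + x := by
      intro y hy
      have := sum_lt_sum_cons (x := x) (B := Multiset.replicate y a) hA ?_
      · rwa [Multiset.sum_replicate, add_comm] at this
      · rw [Multiset.le_iff_count]
        intro z
        rw [Multiset.count_cons, Multiset.count_replicate]
        rcases eq_or_ne z x with rfl | hzx
        · have := Multiset.one_le_count_iff_mem.2 hx
          simpa [hxa.ne'] using this
        · split_ifs with h1
          · subst h1
            simp only [add_zero]
            omega
          · simp
    have h2 : ∀ y < k + 1, y • a + x < (y + 1) • a := by
      intro y hy
      -- If `x` made up for an `a` next to `y • a`, adding `d • a` would make it do so next to `k •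
      -- a`, where `k = y + d`.
      by_contra! hle
      refine absurd hlt (not_lt.2 ?_)
      obtain ⟨d, rfl⟩ := Nat.exists_eq_add_of_le (Nat.lt_succ_iff.1 hy)
      calc (y + d) • a + a = d • a + (y + 1) • a := by rw [add_nsmul, succ_nsmul]; abel
        _ ≤ d • a + (y • a + x) := by gcongr
        _ = (y + d) • a + x := by rw [add_nsmul]; abel
    have h3 := two_mul_le_card_filter_lt_nsmul h1 h2
    have h4 := card_filter_lt_sum_le hA hcard (hrep (y := k + 1) (by omega))
    rw [Multiset.sum_replicate, Multiset.card_replicate] at h4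
    omega
  refine ⟨a, fun heq => ?_⟩
  -- If the multiples stall at `A.card - 1`, that multiple bounds every other one, hence `A.sum` by
  -- `hupper`. By `hlower` it is also at most the sum of `A` without `a`, so deleting `a` loses
  -- nothing.
  have hstab : ∀ d : ℕ, (A.card - 1 + d) • a = (A.card - 1) • a := by
    intro d
    induction d with
    | zero => rfl
    | succ d ih =>
      rw [← add_assoc, succ_nsmul, ih, ← succ_nsmul, Nat.sub_add_cancel (by omega), heq]
  have hle : A.sum ≤ (A.card - 1) • a := by
    calc A.sum ≤ A.card • ((k + 1) • a) := Multiset.sum_le_card_nsmul _ _ hupper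
      _ = ((k + 1) * A.card) • a := by rw [mul_nsmul]
      _ ≤ (A.card - 1 + (k + 1) * A.card) • a := hmono (by omega)
      _ = _ := hstab _
  have hge : (A.card - 1) • a ≤ (A.erase a).sum := by
    have hr : Multiset.replicate k a ≤ A.erase a := by
      rw [← Multiset.le_count_iff_replicate_le, Multiset.count_erase_self]
      omega
    obtain ⟨C, hC⟩ := Multiset.le_iff_exists_add.1 hr
    have hc : A.card - 1 = k + C.card := by
      rw [← Nat.pred_eq_sub_one, ← Multiset.card_erase_of_mem haA, hC]
      simp
    rw [hc, hC, add_nsmul, Multiset.sum_add, Multiset.sum_replicate]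
    refine nsmul_add_card_nsmul_le C fun x hx => hlower x (Multiset.mem_of_mem_erase (a := x) (b := a) ?_)
    rw [hC]
    exact Multiset.mem_add.2 (Or.inr hx)
  exact absurd (hA a haA) (not_lt.2 (hle.trans hge))

end OrderedMonoid

/-! ### Chains of multiples in a distance monoid; transport of structure -/

namespace DistanceMonoid

variable {R S : Type*}

/-- The multiple `i · a`. -/
def mul (M : DistanceMonoid R) (a : R) : ℕ → R
  | 0 => M.zero
  | i + 1 => M.add a (M.mul a i)

/-- The first `m + 1` multiples of `a`, from `0` on, are distinct and exhaust the multiples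
of `a`. -/
def IsChain (M : DistanceMonoid R) (m : ℕ) (a : R) : Prop :=
  (∀ i < m, M.mul a i ≠ M.mul a (i + 1)) ∧ M.mul a (m + 1) = M.mul a m

/-- The additive commutative monoid underlying a distance monoid. -/
@[reducible] def toAddCommMonoid (M : DistanceMonoid R) : AddCommMonoid R where
  add := M.add
  zero := M.zero
  add_assoc := M.add_assoc
  add_comm := M.add_comm
  add_zero := M.add_zero
  zero_add := M.zero_add
  nsmul := @nsmulRec R ⟨M.zero⟩ ⟨M.add⟩

/-- The linear order underlying a distance monoid. -/
@[reducible] noncomputable def toLinearOrder (M : DistanceMonoid R) : LinearOrder R where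
  le := M.le
  le_refl := M.le_refl
  le_trans := M.le_trans
  le_antisymm := M.le_antisymm
  le_total := M.le_total
  toDecidableLE := Classical.decRel _

theorem isOrderedAddMonoid (M : DistanceMonoid R) :
    @IsOrderedAddMonoid R M.toAddCommMonoid M.toLinearOrder.toPreorder :=
  letI := M.toAddCommMonoid
  letI := M.toLinearOrder
  { add_le_add_left := fun a b h c => M.add_le_add a c b c h (M.le_refl c) }

theorem zero_le (M : DistanceMonoid R) (x : R) : M.le M.zero x := by
  have := M.le_add M.zero x
  rwa [M.zero_add] at this

/-- A failure of absorption at `m - 1` is a family of `m` elements whose least member matters. This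
family is irredundant, and absorption at `m` stops the multiples of `a` at `m`. -/
theorem exists_isChain [Fintype R] (M : DistanceMonoid R) {m k : ℕ}
    (hcard : Fintype.card R = m + k + 1)
    (hm : (k + 1) * (k + 1) < m) (h : M.AbsorbsFirst m) (h' : ¬ M.AbsorbsFirst (m - 1)) :
    ∃ a, M.IsChain m a := by
  let := M.toAddCommMonoid
  let := M.toLinearOrder
  have := M.isOrderedAddMonoid
  obtain ⟨p, rfl⟩ : ∃ p, m = p + 1 := ⟨m - 1, by omega⟩
  have hpos : ∀ x : R, 0 ≤ x := M.zero_le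
  have hsum : ∀ {q : ℕ} (r : Fin q → R), M.sum r = (List.ofFn r).sum := fun r => rfl
  have hmul : ∀ (a : R) (i : ℕ), M.mul a i = i • a := by
    intro a i
    induction i with
    | zero => rw [zero_nsmul]; rfl
    | succ i ih => rw [succ_nsmul', ← ih]; rfl
  simp only [AbsorbsFirst, not_forall] at h'
  obtain ⟨r, hr, hne⟩ := h'
  rw [hsum, hsum, List.ofFn_succ, List.sum_cons] at hne
  set T : Multiset R := ((List.ofFn fun i : Fin p => r i.succ : List R) : Multiset R) with hT
  have hTsum : T.sum = (List.ofFn fun i : Fin p => r i.succ).sum := by rw [hT, Multiset.sum_coe]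
  have hTcard : T.card = p := by rw [hT, Multiset.coe_card, List.length_ofFn]
  have hlt : T.sum < (r 0 ::ₘ T).sum := by
    rw [Multiset.sum_cons, hTsum]
    exact lt_of_le_of_ne (le_add_of_nonneg_left (hpos _)) (Ne.symm hne)
  -- Since `r 0` is least, deleting another `x` leaves a sum no larger than deleting `r 0` does.
  have hA : ∀ x ∈ r 0 ::ₘ T, ((r 0 ::ₘ T).erase x).sum < (r 0 ::ₘ T).sum := by
    intro x hx
    refine lt_of_le_of_lt ?_ hlt
    by_cases hx0 : r 0 = x
    · subst hx0
      rw [Multiset.erase_cons_head]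
    · have hxT : x ∈ T := (Multiset.mem_cons.1 hx).resolve_left (Ne.symm hx0)
      rw [Multiset.erase_cons_tail _ hx0, ← Multiset.cons_erase hxT, Multiset.sum_cons,
        Multiset.erase_cons_head, Multiset.sum_cons]
      have : r 0 ≤ x := by
        rw [hT, Multiset.mem_coe, List.mem_ofFn] at hxT
        obtain ⟨i, rfl⟩ := hxT
        exact hr _ _ (Fin.zero_le _)
      gcongr
  have hcA : (r 0 ::ₘ T).card = p + 1 := by rw [Multiset.card_cons, hTcard]
  obtain ⟨a, ha⟩ := exists_nsmul_lt_nsmul (k := k) hpos hA (by rw [hcA, hcard]) (by rw [hcA]; exact hm)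
  rw [hcA, Nat.add_sub_cancel] at ha
  -- A coincidence of consecutive multiples at `i < m` propagates upwards to the multiples `m - 1`
  -- and `m`.
  refine ⟨a, fun i hi heq => ha ?_, ?_⟩
  · rw [hmul, hmul] at heq
    obtain ⟨d, rfl⟩ := Nat.exists_eq_add_of_le (Nat.lt_succ_iff.1 hi)
    rw [show i + d + 1 = i + 1 + d by omega, add_nsmul, add_nsmul, heq]
  · have := h (fun _ => a) fun _ _ _ => M.le_refl a
    rw [hsum, hsum, List.ofFn_const, List.ofFn_const, List.sum_replicate, List.sum_replicate] at this
    rw [hmul, hmul, this]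

theorem absorbsFirst_of_arch_eq (M : DistanceMonoid R) {m : ℕ} (h : M.arch = m) (hm : m ≠ 0) :
    M.AbsorbsFirst m ∧ ¬ M.AbsorbsFirst (m - 1) := by
  have hne : {a : ℕ∞ | ∃ m : ℕ, a = m ∧ M.AbsorbsFirst m}.Nonempty := by
    by_contra hcon
    rw [Set.not_nonempty_iff_eq_empty] at hcon
    rw [arch, hcon, sInf_empty] at h
    exact absurd h (ENat.top_ne_natCast m)
  constructor
  · obtain ⟨q, hq, hq'⟩ := csInf_mem hne
    have : (m : ℕ∞) = q := by rw [← h, ← hq]; rfl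
    rwa [ENat.natCast_inj.1 this]
  · intro hcon
    have h1 : M.arch ≤ (m - 1 : ℕ) := sInf_le ⟨m - 1, rfl, hcon⟩
    rw [h, ENat.natCast_le_natCast] at h1
    omega

/-- Transport of a distance monoid structure along a bijection. -/
def transport (M : DistanceMonoid R) (e : R ≃ S) : DistanceMonoid S where
  add r s := e (M.add (e.symm r) (e.symm s))
  le r s := M.le (e.symm r) (e.symm s)
  zero := e M.zero
  le_refl _ := M.le_refl _
  le_antisymm r s h h' := e.symm.injective (M.le_antisymm _ _ h h')
  le_trans _ _ _ := M.le_trans _ _ _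
  le_total _ _ := M.le_total _ _
  le_add _ _ := by rw [e.symm_apply_apply]; exact M.le_add _ _
  add_le_add _ _ _ _ h h' := by
    rw [e.symm_apply_apply, e.symm_apply_apply]; exact M.add_le_add _ _ _ _ h h'
  add_comm _ _ := by rw [M.add_comm]
  add_zero _ := by rw [e.symm_apply_apply, M.add_zero, e.apply_symm_apply]
  zero_add _ := by rw [e.symm_apply_apply, M.zero_add, e.apply_symm_apply]
  add_assoc _ _ _ := by rw [e.symm_apply_apply, e.symm_apply_apply, M.add_assoc]

theorem isIso_transport (M : DistanceMonoid R) (e : R ≃ S) : M.IsIso (M.transport e) :=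
  ⟨e, fun r s => by simp [transport], fun r s => by simp [transport], rfl⟩

theorem mul_transport (M : DistanceMonoid R) (e : R ≃ S) (a : R) (i : ℕ) :
    (M.transport e).mul (e a) i = e (M.mul a i) := by
  induction i with
  | zero => rfl
  | succ i ih => simp only [mul, ih]; simp [transport]

theorem IsChain.transport {M : DistanceMonoid R} {m : ℕ} {a : R} (h : M.IsChain m a) (e : R ≃ S) :
    (M.transport e).IsChain m (e a) := by
  refine ⟨fun i hi => ?_, ?_⟩
  · rw [mul_transport, mul_transport]
    exact fun heq => h.1 i hi (e.injective heq)
  · rw [mul_transport, mul_transport, h.2]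

theorem exists_transport_le_eq [Fintype R] (M : DistanceMonoid R) {n : ℕ}
    (h : Fintype.card R = n) : ∃ e : R ≃ Fin n, (M.transport e).le = (· ≤ ·) := by
  let := M.toLinearOrder
  refine ⟨(Fintype.orderIsoFinOfCardEq R h).symm.toEquiv, ?_⟩
  funext r s
  exact propext (Fintype.orderIsoFinOfCardEq R h).le_iff_le

end DistanceMonoid

/-! ### Encoding a monoid by its elements off the chain -/

namespace DistanceMonoid

section Code

variable {R : Type*} [LinearOrder R] {M N : DistanceMonoid R} {m k : ℕ} {a : R}

omit [LinearOrder R] in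
theorem mul_one (M : DistanceMonoid R) (a : R) : M.mul a 1 = a := M.add_zero a

omit [LinearOrder R] in
theorem add_mul_mul (M : DistanceMonoid R) (a : R) (p q : ℕ) :
    M.add (M.mul a p) (M.mul a q) = M.mul a (p + q) := by
  induction p with
  | zero => rw [Nat.zero_add]; exact M.zero_add _
  | succ p ih => rw [Nat.succ_add]; simp only [mul]; rw [M.add_assoc, ih]

theorem add_le_add_of_le_eq (hle : M.le = (· ≤ ·)) {u u' v v' : R} (hu : u ≤ u') (hv : v ≤ v') :
    M.add u v ≤ M.add u' v' := by
  have := M.add_le_add u v u' v'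
  rw [hle] at this
  exact this hu hv

theorem mul_le_mul (hle : M.le = (· ≤ ·)) {p q : ℕ} (h : p ≤ q) : M.mul a p ≤ M.mul a q := by
  refine monotone_nat_of_le_succ (f := M.mul a) (fun i => ?_) h
  have := M.le_add (M.mul a i) a
  rw [hle, M.add_comm] at this
  exact this

namespace IsChain

omit [LinearOrder R] in
theorem mul_eq (h : M.IsChain m a) {p : ℕ} (hp : m ≤ p) : M.mul a p = M.mul a m := by
  induction p, hp using Nat.le_induction with
  | base => rfl
  | succ p _ ih => rw [mul, ih]; exact h.2

theorem mul_lt_mul (h : M.IsChain m a) (hle : M.le = (· ≤ ·)) {p q : ℕ} (hpq : p < q)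
    (hp : p < m) : M.mul a p < M.mul a q :=
  (lt_of_le_of_ne (mul_le_mul hle (Nat.le_succ p)) (h.1 p hp)).trans_le (mul_le_mul hle hpq)

theorem strictMono (h : M.IsChain m a) (hle : M.le = (· ≤ ·)) :
    StrictMono fun p : Fin (m + 1) => M.mul a p :=
  fun _ q hpq => h.mul_lt_mul hle hpq (by have := q.2; omega)

end IsChain

/-- The largest `p ≤ m` with `c p ≤ u`. -/
def level (m : ℕ) (c : ℕ → R) (u : R) : ℕ := Nat.findGreatest (fun p => c p ≤ u) m

/-- An element of the range of `b`, or the element at distance `d` above position `l` of `c`. -/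
def decode (c : ℕ → R) (b : Fin k → R) (l : ℕ) : Fin k ⊕ Fin 3 → R :=
  Sum.elim b fun d => c (l + d)

/-- Each summand lies between the multiple at its level and the next one, so a sum on the chain
exceeds the added levels by at most two steps. This leaves `k + 3` values, independently of `m`. -/
theorem IsChain.exists_decode (h : M.IsChain m a) (hle : M.le = (· ≤ ·)) {b : Fin k → R}
    (hb : Set.range b = (Set.range fun p : Fin (m + 1) => M.mul a p)ᶜ) (u v : R) :
    ∃ z, M.add u v =
      decode (M.mul a) b (level m (M.mul a) u + level m (M.mul a) v) z := by
  by_cases hz : M.add u v ∈ Set.range b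
  · obtain ⟨i, hi⟩ := hz
    exact ⟨Sum.inl i, hi.symm⟩
  rw [hb, Set.notMem_compl_iff] at hz
  obtain ⟨q, hq : M.mul a q = _⟩ := hz
  have hqm := Nat.lt_succ_iff.1 q.2
  have hzero : ∀ u, M.mul a 0 ≤ u := fun u => by
    have := M.zero_le u
    rwa [hle] at this
  have hlev : ∀ u, M.mul a (level m (M.mul a) u) ≤ u := fun u =>
    Nat.findGreatest_spec (P := fun p => M.mul a p ≤ u) (Nat.zero_le m) (hzero u)
  have hlev' : ∀ u, level m (M.mul a) u < m → u ≤ M.mul a (level m (M.mul a) u + 1) := by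
    intro u hu
    by_contra! hcon
    exact Nat.findGreatest_is_greatest (P := fun p => M.mul a p ≤ u) (Nat.lt_succ_self _) hu hcon.le
  have hlow : M.mul a (level m (M.mul a) u + level m (M.mul a) v) ≤ M.mul a q := by
    have := add_le_add_of_le_eq hle (hlev u) (hlev v)
    rw [add_mul_mul, ← hq] at this
    exact this
  set lu := level m (M.mul a) u
  set lv := level m (M.mul a) v
  -- Levels are capped at `m`, and the upper bound `hlev'` fails at the cap. Once the levels add up
  -- to `m` or more, the sum is the top multiple and offset `0` serves.
  rcases le_or_gt m (lu + lv) with hm | hm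
  · refine ⟨Sum.inr 0, hq.symm.trans (le_antisymm ?_ hlow)⟩
    rw [decode, Sum.elim_inr, h.mul_eq (p := lu + lv + _) (by simpa using hm)]
    exact mul_le_mul hle hqm
  · have hupp : M.mul a q ≤ M.mul a (lu + lv + 2) := by
      have := add_le_add_of_le_eq hle (hlev' u (by omega)) (hlev' v (by omega))
      rw [add_mul_mul, ← hq] at this
      rwa [show lu + lv + 2 = lu + 1 + (lv + 1) by omega]
    have h1 : lu + lv ≤ q := by
      by_contra! hcon
      exact absurd hlow (not_le.2 (h.mul_lt_mul hle hcon (by omega)))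
    have h2 : (q : ℕ) ≤ lu + lv + 2 := by
      by_contra! hcon
      exact absurd hupp (not_le.2 (h.mul_lt_mul hle hcon (by omega)))
    refine ⟨Sum.inr ⟨q - (lu + lv), by omega⟩, ?_⟩
    rw [decode, Sum.elim_inr, ← hq]
    congr 1
    simp only
    omega

/-- The data of `M` relative to the multiples of `a`: `b` enumerates the other elements, `t` gives
the sums `a ⊕ b i` and `s` the sums `b i ⊕ b j`. -/
structure IsCode (M : DistanceMonoid R) (m : ℕ) (a : R) (b : Fin k → R)
    (t : Fin k → Fin k ⊕ Fin 3) (s : Fin k → Fin k → Fin k ⊕ Fin 3) : Prop where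
  le_eq : M.le = (· ≤ ·)
  isChain : M.IsChain m a
  range_eq : Set.range b = (Set.range fun p : Fin (m + 1) => M.mul a p)ᶜ
  add_left (i : Fin k) : M.add a (b i) =
    decode (M.mul a) b (level m (M.mul a) a + level m (M.mul a) (b i)) (t i)
  add_add (i j : Fin k) : M.add (b i) (b j) =
    decode (M.mul a) b (level m (M.mul a) (b i) + level m (M.mul a) (b j)) (s i j)

theorem IsChain.exists_isCode [Fintype R] (h : M.IsChain m a) (hle : M.le = (· ≤ ·))
    (hcard : Fintype.card R = m + k + 1) :
    ∃ (b : Fin k → R) (t : Fin k → Fin k ⊕ Fin 3) (s : Fin k → Fin k → Fin k ⊕ Fin 3),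
      M.IsCode m a b t s := by
  obtain ⟨b, hb⟩ : ∃ b : Fin k → R,
      Set.range b = (Set.range fun p : Fin (m + 1) => M.mul a p)ᶜ := by
    let F : Finset R := (Finset.univ.image fun p : Fin (m + 1) => M.mul a p)ᶜ
    have hF : F.card = k := by
      rw [Finset.card_compl, Finset.card_image_of_injective _ (h.strictMono hle).injective,
        Finset.card_univ, Fintype.card_fin, hcard]
      omega
    refine ⟨F.orderEmbOfFin hF, ?_⟩
    rw [Finset.range_orderEmbOfFin]
    simp [F]
  choose z hz using h.exists_decode hle hb
  exact ⟨b, fun i => z a (b i), fun i j => z (b i) (b j), hle, h, hb, fun i => hz _ _,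
    fun i j => hz _ _⟩

/-- The complement of the range of `b` is the chain, and its increasing enumeration recovers all
multiples, including `a`. Sums of multiples are then known, `s` gives the sums within `b`, and `t`
gives the mixed sums by adding `a` repeatedly. -/
theorem IsCode.eq {a' : R} {b : Fin k → R} {t : Fin k → Fin k ⊕ Fin 3}
    {s : Fin k → Fin k → Fin k ⊕ Fin 3} (hM : M.IsCode m a b t s) (hN : N.IsCode m a' b t s) : M = N := by
  have hc : M.mul a = N.mul a' := by
    have h1 := (hM.isChain.strictMono hM.le_eq).range_inj (hN.isChain.strictMono hN.le_eq)
    have h2 := h1.1 (compl_injective (hM.range_eq.symm.trans hN.range_eq))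
    funext p
    rcases le_or_gt m p with hp | hp
    · rw [hM.isChain.mul_eq hp, hN.isChain.mul_eq hp]
      exact congrFun h2 (Fin.last m)
    · exact congrFun h2 ⟨p, by omega⟩
  have ha : a = a' := by rw [← M.mul_one a, hc, N.mul_one]
  subst ha
  have hcases : ∀ u, (∃ i, u = b i) ∨ ∃ p, u = M.mul a p := by
    intro u
    by_cases hu : u ∈ Set.range b
    · exact Or.inl (hu.imp fun _ h => h.symm)
    · rw [hM.range_eq, Set.notMem_compl_iff] at hu
      obtain ⟨p, hp⟩ := hu
      exact Or.inr ⟨p, hp.symm⟩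
  have hmm : ∀ p q, M.add (M.mul a p) (M.mul a q) = N.add (M.mul a p) (M.mul a q) := by
    intro p q
    rw [M.add_mul_mul, hc, N.add_mul_mul]
  have hab : ∀ i, M.add a (b i) = N.add a (b i) := fun i => by
    rw [hM.add_left, hN.add_left, hc]
  have hcb : ∀ p i, M.add (M.mul a p) (b i) = N.add (M.mul a p) (b i) := by
    intro p
    induction p with
    | zero =>
      intro i
      have h0 : M.mul a 0 = N.zero := by rw [hc]; rfl
      rw [h0, N.zero_add, ← h0]
      exact M.zero_add _
    | succ p ih =>
      intro i
      have e1 : M.add (M.mul a (p + 1)) (b i) = M.add (M.mul a p) (M.add a (b i)) := by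
        rw [mul, M.add_comm a, M.add_assoc]
      have e2 : N.add (M.mul a (p + 1)) (b i) = N.add (M.mul a p) (N.add a (b i)) := by
        rw [hc, mul, N.add_comm a, N.add_assoc]
      rw [e1, e2, ← hab]
      -- The element `a ⊕ b i` is again some `b j`, settled by the induction hypothesis for all
      -- indices, or a multiple of `a`.
      rcases hcases (M.add a (b i)) with ⟨j, hj⟩ | ⟨q, hq⟩
      · rw [hj, ih]
      · rw [hq, hmm]
  have hadd : M.add = N.add := by
    funext u v
    rcases hcases u with ⟨i, rfl⟩ | ⟨p, rfl⟩ <;> rcases hcases v with ⟨j, rfl⟩ | ⟨q, rfl⟩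
    · rw [hM.add_add, hN.add_add, hc]
    · rw [M.add_comm, N.add_comm, hcb]
    · exact hcb _ _
    · exact hmm _ _
  exact DistanceMonoid.ext hadd (hM.le_eq.trans hN.le_eq.symm) (congrFun hc 0)

end Code

end DistanceMonoid

/-! ### Counting codes -/

open DistanceMonoid in
theorem DM_le {m k : ℕ} (hm : (k + 1) * (k + 1) < m) :
    DM (m + k) m ≤ (m + k + 1) ^ k * ((k + 3) ^ k * ((k + 3) ^ k) ^ k) := by
  -- Codes presuppose the standard order on `Fin`, so each class is represented by a transported
  -- copy `N`. Equal codes give equal copies, hence equal classes.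
  have key : ∀ q : Quotient (isoSetoid (m + k) m),
      ∃ (x : (Fin k → Fin (m + k + 1)) × (Fin k → Fin k ⊕ Fin 3) ×
        (Fin k → Fin k → Fin k ⊕ Fin 3)) (N : DistanceMonoid (Fin (m + k + 1)))
        (a : Fin (m + k + 1)), q.out.1.IsIso N ∧ N.IsCode m a x.1 x.2.1 x.2.2 := by
    intro q
    obtain ⟨h1, h2⟩ := absorbsFirst_of_arch_eq q.out.1 q.out.2 (by omega)
    obtain ⟨a, ha⟩ := exists_isChain q.out.1 (Fintype.card_fin _) hm h1 h2
    obtain ⟨e, he⟩ := exists_transport_le_eq q.out.1 (Fintype.card_fin _)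
    obtain ⟨b, t, s, hcode⟩ := (ha.transport e).exists_isCode he (Fintype.card_fin _)
    exact ⟨(b, t, s), _, _, isIso_transport _ e, hcode⟩
  choose x N a hiso hcode using key
  have hinj : Function.Injective x := by
    intro q q' hq
    have h1 := hcode q
    rw [hq] at h1
    have h2 := h1.eq (hcode q')
    rw [← q.out_eq, ← q'.out_eq]
    exact Quotient.sound ((hiso q).trans (h2 ▸ (hiso q').symm))
  refine (Nat.card_le_card_of_injective x hinj).trans (le_of_eq ?_)
  simp [Nat.card_eq_fintype_card]

theorem theorem2 (k : ℕ) :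
    (fun n : ℕ => (DM n (n - k) : ℝ)) =O[atTop] (fun n : ℕ => (n : ℝ) ^ k) := by
  -- The factor `2 ^ k` absorbs `n + 1 ≤ 2 * n`; the remaining factors count the tables `t` and `s`.
  refine IsBigO.of_bound ((2 : ℝ) ^ k * ((k + 3) ^ k * ((k + 3) ^ k) ^ k)) ?_
  filter_upwards [eventually_ge_atTop ((k + 1) * (k + 1) + 1 + k)] with n hn
  obtain ⟨m, rfl⟩ : ∃ m, n = m + k := ⟨n - k, by omega⟩
  rw [Nat.add_sub_cancel, Real.norm_of_nonneg (by positivity), Real.norm_of_nonneg (by positivity)]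
  have h1 : (DM (m + k) m : ℝ) ≤
      ((m + k : ℕ) + 1 : ℝ) ^ k * ((k + 3) ^ k * ((k + 3) ^ k) ^ k) := by
    exact_mod_cast DM_le (m := m) (k := k) (by omega)
  have h2 : (1 : ℝ) ≤ (m + k : ℕ) := by
    exact_mod_cast (by omega : 1 ≤ m + k)
  calc (DM (m + k) m : ℝ)
      ≤ ((m + k : ℕ) + 1 : ℝ) ^ k * ((k + 3) ^ k * ((k + 3) ^ k) ^ k) := h1
    _ ≤ (2 * (m + k : ℕ) : ℝ) ^ k * ((k + 3) ^ k * ((k + 3) ^ k) ^ k) := by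
      gcongr
      linarith
    _ = 2 ^ k * ((k + 3) ^ k * ((k + 3) ^ k) ^ k) * ((m + k : ℕ) : ℝ) ^ k := by
      rw [mul_pow]; ring
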